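/- Consider a D/GI/1/1 system: a single source generates packets at the instants $\varphi + j/\lambda$, $j = 0,1,2,\dots$, where $\lambda>0$ and the phase $\varphi$ is a real random variable; there is one server and no queue, service is non-preemptive, and a packet that arrives while the server is busy is discarded (a packet arriving exactly at a departure instant finds the server idle). Let $X_k>0$ be the service time of the $k$th served packet, let $T_A(k)$ be its arrival time, and let $T_D(k)=T_A(k)+X_k$ be its departure time, $k\ge 0$; here $T_A(0)=\varphi$, and packet $0$, as well as the update held by the receiver before $T_D(0)$, which was generated at some time $\theta\le\varphi$, are part of the initial condition. The service times $X_k$, $k\ge 1$, are i.i.d. and almost surely positive, with $\mathbb E[X_1]<\infty$; the initial condition $(\varphi,\theta,X_0)$ is arbitrary. The age of information at time $t$ is $$\Delta(t)=t-\max\big(\{\theta\}\cup\{T_A(n): T_D(n)\le t\}\big).$$ Let $d\ge 1/\lambda$. For $k\ge 1$ let $I_k=T_A(k)-T_D(k-1)$ be the idle time before the service of packet $k$, and let $g(k)$ be the amount of time in $[T_D(k-1),T_D(k))$ during which $\Delta(t)>d$. Then, almost surely, for all $k\ge 1$, $$I_k=\frac{\lceil\lambda X_{k-1}\rceil}{\lambda}-X_{k-1},\qquad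 g(k)=\min\{(X_{k-1}+I_k+X_k-d)^+,\;X_k+I_k\}.$$ Moreover, for all $k\ge 2$, with $$\nu=\frac{\lambda}{\mathbb E[\lceil\lambda X_{k-1}\rceil]}=\frac1{\mathbb E[T_D(k)-T_D(k-1)]}\in(0,\infty),\qquad \mathbb E[g(k)]<\infty,$$ the violation probability equals $\nu\,\mathbb E[g(k)]$ in the following sense: 1. Almost surely, the long-run fraction of time in which the age exceeds $d$ is $$\lim_{T\to\infty}\frac1T\int_0^T \mathbf 1\{\Delta(t)>d\}\,dt=\nu\,\mathbb E[g(k)].$$ 2. If the steady-state violation probability $\lim_{t\to\infty}\mathbb P(\Delta(t)>d)$ exists, then it equals $\nu\,\mathbb E[g(k)]$. 3. If the age process $(\Delta(t))_{t\ge 0}$ is stationary, then the steady-state violation probability exists and equals $\nu\,\mathbb E[g(k)]$. -/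

import Mathlib

open MeasureTheory ProbabilityTheory Filter Topology

noncomputable section

/-- Arrival instants of a deterministic arrival stream of rate `lam`, the packet with index `0`
arriving at time `phase`. -/
def dArrival (lam phase : ℝ) (j : ℕ) : ℝ := phase + j / lam

/-- Index (in the stream of arrivals `a`) of the `k`-th served packet of a single-server system
without any queue and without preemption. Packet `0` of the stream is served upon arrival.
The service of the `k`-th served packet takes time `x k`; arrivals during it are
discarded, and the next served packet is the first later arrival that finds the server idle
(an arrival at the very instant of a departure finds the server idle). -/
def servedIdx (a x : ℕ → ℝ) : ℕ → ℕ
  | 0 => 0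
  | k + 1 => sInf {j : ℕ | servedIdx a x k < j ∧ a (servedIdx a x k) + x k ≤ a j}

/-- Arrival time of the `k`-th served packet. -/
def arrTime (a x : ℕ → ℝ) (k : ℕ) : ℝ := a (servedIdx a x k)

/-- Departure time of the `k`-th served packet. -/
def depTime (a x : ℕ → ℝ) (k : ℕ) : ℝ := arrTime a x k + x k

/-- Idle time of the server just before the service of packet `k + 1`. -/
def idleTime (a x : ℕ → ℝ) (k : ℕ) : ℝ := arrTime a x (k + 1) - depTime a x k

/-- Age of information at time `t`: the time elapsed since the generation of the newest update
that has been delivered by time `t`. The number `init` is the generation time of the update that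
the receiver holds before the departure of packet `0`. -/
def ageOfInfo (a x : ℕ → ℝ) (init t : ℝ) : ℝ :=
  t - sSup ({init} ∪ {s : ℝ | ∃ n : ℕ, depTime a x n ≤ t ∧ s = arrTime a x n})

/-- The time for which the age exceeds `d` between the departures (which are the
age peaks) of packets `k` and `k + 1`. -/
def excessTime (a x : ℕ → ℝ) (init d : ℝ) (k : ℕ) : ℝ :=
  volume.real {t : ℝ | depTime a x k ≤ t ∧ t < depTime a x (k + 1) ∧ d < ageOfInfo a x init t}

/-- `p` is the steady-state violation probability `lim_{t → ∞} P(Y t > d)`. -/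
def IsViolationProb {Ω : Type*} [MeasurableSpace Ω] (P : Measure Ω) (Y : ℝ → Ω → ℝ) (d p : ℝ) :
    Prop :=
  Tendsto (fun t : ℝ => P.real {ω | d < Y t ω}) atTop (𝓝 p)

/-- Strict stationarity of the process `Y` on the time axis `[0, ∞)`: the finite-dimensional
distributions are invariant under time shifts. -/
def IsStationaryProcess {Ω : Type*} [MeasurableSpace Ω] (P : Measure Ω) (Y : ℝ → Ω → ℝ) : Prop :=
  ∀ (n : ℕ) (s : Fin n → ℝ) (h : ℝ), (∀ i, 0 ≤ s i) → 0 ≤ h →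
    IdentDistrib (fun ω i => Y (s i + h) ω) (fun ω i => Y (s i) ω) P P

/-- A D/GI/1/1 system with arrival rate `lam`, observed from time `0` on. `X k` is the
service time of the `k`-th served packet, `phase` the arrival time of packet `0`, and `init` the
generation time of the update held by the receiver before packet `0` is delivered. Packet `0`
belongs to the initial condition, which is arbitrary: packet `0` may for instance be in service
at time `0`, so that a stationary start is possible and so is a start with an empty system
(where `X 0` is distributed as the other service times). -/
structure IsDGI11 {Ω : Type*} [MeasurableSpace Ω] (P : Measure Ω) (lam : ℝ)
    (X : ℕ → Ω → ℝ) (phase init : Ω → ℝ) : Prop where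
  rate_pos : 0 < lam
  measurable_service : ∀ k, Measurable (X k)
  measurable_phase : Measurable phase
  measurable_init : Measurable init
  service_pos : ∀ k, ∀ᵐ ω ∂P, 0 < X k ω
  init_le : ∀ᵐ ω ∂P, init ω ≤ phase ω
  indep : iIndepFun (fun k => X (k + 1)) P
  identDistrib : ∀ k, IdentDistrib (X (k + 1)) (X 1) P P

/-- The age process of a D/GI/1/1 system. -/
def dgiAge {Ω : Type*} (lam : ℝ) (X : ℕ → Ω → ℝ) (phase init : Ω → ℝ) (t : ℝ) (ω : Ω) : ℝ :=
  ageOfInfo (dArrival lam (phase ω)) (fun k => X k ω) (init ω) t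

/-- The value `⌈λ X_k⌉ / λ - X_k` for the idle time before the service of packet `k + 1`. -/
def dgiIdle {Ω : Type*} (lam : ℝ) (X : ℕ → Ω → ℝ) (k : ℕ) (ω : Ω) : ℝ :=
  (⌈lam * X k ω⌉ : ℝ) / lam - X k ω

/-- With `I` the idle time `⌈λ X_k⌉ / λ - X_k`, the value
`min {(X_k + I + X_{k+1} - d)^+, X_{k+1} + I}` for the excess time between the departures of
packets `k` and `k + 1`. -/
def dgiExcess {Ω : Type*} (lam d : ℝ) (X : ℕ → Ω → ℝ) (k : ℕ) (ω : Ω) : ℝ :=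
  min (max 0 (X k ω + dgiIdle lam X k ω + X (k + 1) ω - d)) (X (k + 1) ω + dgiIdle lam X k ω)

/-- `λ / E[⌈λ X_k⌉]`. -/
def dgiRate {Ω : Type*} [MeasurableSpace Ω] (P : Measure Ω) (lam : ℝ) (X : ℕ → Ω → ℝ) (k : ℕ) :
    ℝ :=
  lam / ∫ ω, (⌈lam * X k ω⌉ : ℝ) ∂P

end

/-! Consider a path with positive service times and `init ≤ phase`. Arrivals form a grid of step `1
/ lam`, so the next served packet comes `⌈lam * x k⌉` slots after packet `k` (`servedIdx_succ`).
Arrival times are thus partial sums of ceilings. Between departures `k` and `k + 1` the age is `t`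
minus the arrival time of packet `k`, so the excess time is the length of an interval
(`excessTime_eq`).

The long-run fraction then follows from renewal-reward (`tendsto_measureReal_inter_Ioc_div`): mean
excess per cycle over mean cycle length. The ceilings obey the strong law directly. Consecutive
excess times share a service time, so the strong law is applied to even and odd indices separately.
Cycles are counted from the departure of packet 1, because the law of `X 0` and its dependence on
the rest are arbitrary.

By Fubini, the Cesàro mean of `P(Δ(t) > d)` is the expected violation fraction, which converges by
dominated convergence. If the probability itself converges, its limit must be the same number. Under
stationarity it is constant in time, hence converges. -/

theorem exists_mem_Ico_of_tendsto {D : ℕ → ℝ} {t : ℝ} (ht : D 0 ≤ t) (hD : Tendsto D atTop atTop) :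
    ∃ k, t ∈ Set.Ico (D k) (D (k + 1)) := by
  obtain ⟨n, hn⟩ := (hD.eventually_gt_atTop t).exists
  by_contra! h
  have : ∀ k, D k ≤ t := fun k => by
    induction k with
    | zero => exact ht
    | succ k ih => exact not_lt.1 fun hlt => h k ⟨ih, hlt⟩
  exact absurd hn (this n).not_gt

/-! ### Sample paths: served packets, age and excess times. -/

section Path

variable {lam φ : ℝ} {x : ℕ → ℝ}

/-- Measured in slots, the service ends `lam * x k` after its start. Positivity makes the ceiling at
least 1, so the strict index inequality in the definition is automatic. -/
theorem servedIdx_succ (hlam : 0 < lam) (hx : ∀ k, 0 < x k) (k : ℕ) :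
    servedIdx (dArrival lam φ) x (k + 1) = servedIdx (dArrival lam φ) x k + ⌈lam * x k⌉₊ := by
  have hset : {j : ℕ | servedIdx (dArrival lam φ) x k < j ∧
      dArrival lam φ (servedIdx (dArrival lam φ) x k) + x k ≤ dArrival lam φ j}
      = Set.Ici (servedIdx (dArrival lam φ) x k + ⌈lam * x k⌉₊) := by
    ext j
    generalize servedIdx (dArrival lam φ) x k = i
    have hpos : 0 < lam * x k := mul_pos hlam (hx k)
    have hc : 0 < ⌈lam * x k⌉₊ := Nat.ceil_pos.2 hpos
    have key : dArrival lam φ i + x k ≤ dArrival lam φ j ↔ (i : ℝ) + lam * x k ≤ j := by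
      unfold dArrival
      rw [show φ + (i : ℝ) / lam + x k = φ + (i + lam * x k) / lam by field_simp; ring,
        add_le_add_iff_left, div_le_div_iff_of_pos_right hlam]
    simp only [Set.mem_ofPred_eq, Set.mem_Ici, key]
    constructor
    · rintro ⟨hij, h⟩
      have : ⌈lam * x k⌉₊ ≤ j - i := by
        rw [Nat.ceil_le, Nat.cast_sub hij.le]
        linarith
      omega
    · intro h
      refine ⟨by omega, ?_⟩
      have h1 := Nat.le_ceil (lam * x k)
      have h2 : (i : ℝ) + ⌈lam * x k⌉₊ ≤ j := by exact_mod_cast h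
      linarith
  rw [servedIdx, hset, csInf_Ici]

theorem arrTime_zero : arrTime (dArrival lam φ) x 0 = φ := by
  simp [arrTime, servedIdx, dArrival]

theorem arrTime_succ (hlam : 0 < lam) (hx : ∀ k, 0 < x k) (k : ℕ) :
    arrTime (dArrival lam φ) x (k + 1)
      = arrTime (dArrival lam φ) x k + (⌈lam * x k⌉ : ℝ) / lam := by
  have h : ((⌈lam * x k⌉₊ : ℕ) : ℝ) = (⌈lam * x k⌉ : ℝ) :=
    natCast_ceil_eq_intCast_ceil (mul_pos hlam (hx k)).le
  rw [arrTime, servedIdx_succ hlam hx, arrTime, dArrival, dArrival, Nat.cast_add, h]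
  ring

theorem arrTime_eq_sum (hlam : 0 < lam) (hx : ∀ k, 0 < x k) (k : ℕ) :
    arrTime (dArrival lam φ) x k = φ + (∑ i ∈ Finset.range k, (⌈lam * x i⌉ : ℝ)) / lam := by
  induction k with
  | zero => simp [arrTime_zero]
  | succ k ih => rw [arrTime_succ hlam hx, ih, Finset.sum_range_succ]; ring

theorem depTime_le_arrTime_succ (hlam : 0 < lam) (hx : ∀ k, 0 < x k) (k : ℕ) :
    depTime (dArrival lam φ) x k ≤ arrTime (dArrival lam φ) x (k + 1) := by
  rw [depTime, arrTime_succ hlam hx, add_le_add_iff_left, le_div_iff₀ hlam, mul_comm]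
  exact Int.le_ceil _

theorem arrTime_lt_depTime (hx : ∀ k, 0 < x k) (k : ℕ) :
    arrTime (dArrival lam φ) x k < depTime (dArrival lam φ) x k :=
  lt_add_of_pos_right _ (hx k)

theorem strictMono_depTime (hlam : 0 < lam) (hx : ∀ k, 0 < x k) :
    StrictMono (depTime (dArrival lam φ) x) :=
  strictMono_nat_of_lt_succ fun k =>
    (depTime_le_arrTime_succ hlam hx k).trans_lt (arrTime_lt_depTime hx _)

theorem strictMono_arrTime (hlam : 0 < lam) (hx : ∀ k, 0 < x k) :
    StrictMono (arrTime (dArrival lam φ) x) :=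
  strictMono_nat_of_lt_succ fun k =>
    (arrTime_lt_depTime hx _).trans_le (depTime_le_arrTime_succ hlam hx k)

/-- Each ceiling is at least 1. This makes the departure times unbounded on every such path, without
any moment condition. -/
theorem le_arrTime (hlam : 0 < lam) (hx : ∀ k, 0 < x k) (k : ℕ) :
    φ + k / lam ≤ arrTime (dArrival lam φ) x k := by
  rw [arrTime_eq_sum hlam hx]
  gcongr
  have h : ∑ i ∈ Finset.range k, (1 : ℝ) ≤ ∑ i ∈ Finset.range k, (⌈lam * x i⌉ : ℝ) :=
    Finset.sum_le_sum fun i _ => by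
      have : 0 < ⌈lam * x i⌉ := Int.ceil_pos.2 (mul_pos hlam (hx i))
      exact_mod_cast this
  simpa using h

theorem tendsto_depTime (hlam : 0 < lam) (hx : ∀ k, 0 < x k) :
    Tendsto (depTime (dArrival lam φ) x) atTop atTop := by
  refine tendsto_atTop_mono
    (fun k => (le_arrTime hlam hx k).trans (arrTime_lt_depTime hx k).le) ?_
  exact tendsto_atTop_add_const_left _ _ (tendsto_natCast_atTop_atTop.atTop_div_const hlam)

theorem idleTime_eq (hlam : 0 < lam) (hx : ∀ k, 0 < x k) (k : ℕ) :
    idleTime (dArrival lam φ) x k = (⌈lam * x k⌉ : ℝ) / lam - x k := by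
  rw [idleTime, depTime, arrTime_succ hlam hx]
  ring

theorem ageOfInfo_of_lt_depTime_zero {init t : ℝ} (hlam : 0 < lam) (hx : ∀ k, 0 < x k)
    (ht : t < depTime (dArrival lam φ) x 0) :
    ageOfInfo (dArrival lam φ) x init t = t - init := by
  have : {s : ℝ | ∃ n : ℕ, depTime (dArrival lam φ) x n ≤ t ∧ s = arrTime (dArrival lam φ) x n}
      = ∅ := by
    refine Set.eq_empty_of_forall_notMem ?_
    rintro s ⟨n, hn, -⟩
    exact absurd (hn.trans_lt ht) ((strictMono_depTime hlam hx).monotone (Nat.zero_le n)).not_gt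
  rw [ageOfInfo, this, Set.union_empty, csSup_singleton]

theorem ageOfInfo_of_mem_Ico {init t : ℝ} {k : ℕ} (hlam : 0 < lam) (hx : ∀ k, 0 < x k)
    (hinit : init ≤ φ) (ht : depTime (dArrival lam φ) x k ≤ t)
    (ht' : t < depTime (dArrival lam φ) x (k + 1)) :
    ageOfInfo (dArrival lam φ) x init t = t - arrTime (dArrival lam φ) x k := by
  have : IsGreatest ({init} ∪ {s : ℝ | ∃ n : ℕ, depTime (dArrival lam φ) x n ≤ t ∧
      s = arrTime (dArrival lam φ) x n}) (arrTime (dArrival lam φ) x k) := by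
    refine ⟨Or.inr ⟨k, ht, rfl⟩, ?_⟩
    rintro s (rfl | ⟨n, hn, rfl⟩)
    · exact hinit.trans <| (arrTime_zero (lam := lam) (x := x)).symm.trans_le <|
        (strictMono_arrTime hlam hx).monotone (Nat.zero_le k)
    · have : n < k + 1 := (strictMono_depTime hlam hx).lt_iff_lt.1 (hn.trans_lt ht')
      exact (strictMono_arrTime hlam hx).monotone (Nat.lt_succ_iff.1 this)
  rw [ageOfInfo, this.csSup_eq]

theorem setOf_lt_ageOfInfo_inter_Ico {init : ℝ} (hlam : 0 < lam) (hx : ∀ k, 0 < x k)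
    (hinit : init ≤ φ) (d : ℝ) (k : ℕ) :
    {t | d < ageOfInfo (dArrival lam φ) x init t} ∩
        Set.Ico (depTime (dArrival lam φ) x k) (depTime (dArrival lam φ) x (k + 1))
      = Set.Ico (depTime (dArrival lam φ) x k) (depTime (dArrival lam φ) x (k + 1)) ∩
        Set.Ioi (arrTime (dArrival lam φ) x k + d) := by
  ext t
  simp only [Set.mem_inter_iff, Set.mem_ofPred_eq, Set.mem_Ico, Set.mem_Ioi]
  constructor
  · rintro ⟨h, h1, h2⟩
    rw [ageOfInfo_of_mem_Ico hlam hx hinit h1 h2] at h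
    exact ⟨⟨h1, h2⟩, by linarith⟩
  · rintro ⟨⟨h1, h2⟩, h⟩
    rw [ageOfInfo_of_mem_Ico hlam hx hinit h1 h2]
    exact ⟨by linarith, h1, h2⟩

theorem excessTime_eq_inter (a : ℕ → ℝ) (init d : ℝ) (k : ℕ) :
    excessTime a x init d k = volume.real ({t | d < ageOfInfo a x init t} ∩
      Set.Ico (depTime a x k) (depTime a x (k + 1))) := by
  rw [excessTime]
  congr 1
  ext t
  simp only [Set.mem_inter_iff, Set.mem_ofPred_eq, Set.mem_Ico]
  tauto

/-- The minimum caps the length at `b - a` when the threshold `c` lies before `a`. -/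
theorem volume_real_Ico_inter_Ioi {a b c : ℝ} (hab : a ≤ b) :
    volume.real (Set.Ico a b ∩ Set.Ioi c) = min (max 0 (b - c)) (b - a) := by
  have h : (Set.Ico a b ∩ Set.Ioi c : Set ℝ) =ᵐ[volume] (Set.Ioo (max a c) b : Set ℝ) := by
    rw [← Set.Ioi_inter_Iio, ← Set.Ioi_inter_Ioi, ← Set.Ici_inter_Iio, Set.inter_right_comm]
    exact (Ioi_ae_eq_Ici.symm.inter (ae_eq_refl _)).inter (ae_eq_refl _)
  rw [measureReal_congr h, Real.volume_real_Ioo]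
  rcases le_total a c with hac | hac
  · rw [max_eq_right hac, max_comm, min_eq_left (max_le (by linarith) (by linarith))]
  · rw [max_eq_left hac, max_eq_left (by linarith), max_eq_right (by linarith),
      min_eq_right (by linarith)]

theorem excessTime_eq {init : ℝ} (hlam : 0 < lam) (hx : ∀ k, 0 < x k)
    (hinit : init ≤ φ) (d : ℝ) (k : ℕ) :
    excessTime (dArrival lam φ) x init d k
      = min (max 0 (x k + ((⌈lam * x k⌉ : ℝ) / lam - x k) + x (k + 1) - d))
        (x (k + 1) + ((⌈lam * x k⌉ : ℝ) / lam - x k)) := by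
  rw [excessTime_eq_inter, setOf_lt_ageOfInfo_inter_Ico hlam hx hinit,
    volume_real_Ico_inter_Ioi ((strictMono_depTime hlam hx).monotone (Nat.le_succ k)),
    depTime, depTime, arrTime_succ hlam hx]
  congr 2 <;> ring

/-- Replaces the supremum in the age by countably many inequalities between arrival and departure
times, from which joint measurability can be read off. -/
theorem lt_ageOfInfo_iff {init d t : ℝ} (hlam : 0 < lam) (hx : ∀ k, 0 < x k)
    (hinit : init ≤ φ) :
    d < ageOfInfo (dArrival lam φ) x init t ↔
      (t < depTime (dArrival lam φ) x 0 ∧ d < t - init) ∨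
      ∃ k, depTime (dArrival lam φ) x k ≤ t ∧ t < depTime (dArrival lam φ) x (k + 1) ∧
        d < t - arrTime (dArrival lam φ) x k := by
  have hmono := (strictMono_depTime (φ := φ) hlam hx).monotone
  rcases lt_or_ge t (depTime (dArrival lam φ) x 0) with ht | ht
  · rw [ageOfInfo_of_lt_depTime_zero hlam hx ht]
    refine ⟨fun h => Or.inl ⟨ht, h⟩, ?_⟩
    rintro (h | ⟨k, hk, -⟩)
    · exact h.2
    · exact absurd (hk.trans_lt ht) (hmono (Nat.zero_le k)).not_gt
  · constructor
    · intro h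
      obtain ⟨k, hk, hk'⟩ := exists_mem_Ico_of_tendsto ht (tendsto_depTime hlam hx)
      exact Or.inr ⟨k, hk, hk', by rwa [ageOfInfo_of_mem_Ico hlam hx hinit hk hk'] at h⟩
    · rintro (h | ⟨k, hk, hk', h⟩)
      · exact absurd h.1 ht.not_gt
      · rwa [ageOfInfo_of_mem_Ico hlam hx hinit hk hk']

end Path

/-! ### Limits of averages along a fixed sequence or function. -/

section Deterministic

theorem tendsto_comp_add_one_div {u : ℕ → ℝ} {l : ℝ}
    (h : Tendsto (fun n : ℕ => u n / n) atTop (𝓝 l)) :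
    Tendsto (fun n : ℕ => u (n + 1) / n) atTop (𝓝 l) := by
  have h1 := (tendsto_add_atTop_iff_nat 1).2 h
  have h2 : Tendsto (fun n : ℕ => 1 + 1 / (n : ℝ)) atTop (𝓝 (1 + 0)) :=
    tendsto_const_nhds.add tendsto_one_div_atTop_nhds_zero_nat
  have h3 := h1.mul h2
  rw [add_zero, mul_one] at h3
  refine h3.congr' ?_
  filter_upwards [eventually_gt_atTop 0] with n hn
  have : (n : ℝ) ≠ 0 := by positivity
  have : (n : ℝ) + 1 ≠ 0 := by positivity
  push_cast
  field_simp

theorem tendsto_sum_div_of_even_odd {u : ℕ → ℝ} {l : ℝ}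
    (he : Tendsto (fun n : ℕ => (∑ i ∈ Finset.range n, u (2 * i)) / n) atTop (𝓝 l))
    (ho : Tendsto (fun n : ℕ => (∑ i ∈ Finset.range n, u (2 * i + 1)) / n) atTop (𝓝 l)) :
    Tendsto (fun n : ℕ => (∑ i ∈ Finset.range n, u i) / n) atTop (𝓝 l) := by
  have hsplit : ∀ n, ∑ i ∈ Finset.range (2 * n), u i
      = ∑ i ∈ Finset.range n, u (2 * i) + ∑ i ∈ Finset.range n, u (2 * i + 1) := by
    intro n
    induction n with
    | zero => simp
    | succ n ih =>
      rw [show 2 * (n + 1) = 2 * n + 1 + 1 by ring]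
      simp only [Finset.sum_range_succ, ih]
      ring
  have hhalf : Tendsto (fun n : ℕ => (∑ i ∈ Finset.range (2 * n), u i) / ((2 * n : ℕ) : ℝ))
      atTop (𝓝 l) := by
    have h := (he.add ho).div_const 2
    rw [add_self_div_two] at h
    refine h.congr fun n => ?_
    rw [hsplit, ← add_div, div_div, Nat.cast_mul, mul_comm, Nat.cast_two]
  have hhalf' : Tendsto
      (fun n : ℕ => (∑ i ∈ Finset.range (2 * n + 1), u i) / ((2 * n + 1 : ℕ) : ℝ))
      atTop (𝓝 l) := by
    have h1 := tendsto_comp_add_one_div he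
    have h2 := (h1.add ho).div_const 2
    rw [add_self_div_two] at h2
    -- Corrects the normalisation from `2 * n` to the actual number `2 * n + 1` of terms.
    have h3 : Tendsto (fun n : ℕ => (2 * (n : ℝ)) / (2 * n + 1)) atTop (𝓝 1) := by
      have := tendsto_natCast_div_add_atTop (1 / 2 : ℝ)
      refine this.congr fun n => ?_
      have : (n : ℝ) + 1 / 2 ≠ 0 := by positivity
      have : 2 * (n : ℝ) + 1 ≠ 0 := by positivity
      field_simp
    have h4 := h2.mul h3
    rw [mul_one] at h4
    refine h4.congr' ?_
    filter_upwards [eventually_gt_atTop 0] with n hn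
    have : (n : ℝ) ≠ 0 := by positivity
    have : 2 * (n : ℝ) + 1 ≠ 0 := by positivity
    rw [Finset.sum_range_succ _ (2 * n), hsplit, Finset.sum_range_succ _ n]
    push_cast
    field_simp
    ring
  rw [Metric.tendsto_atTop] at hhalf hhalf' ⊢
  intro ε hε
  obtain ⟨N, hN⟩ := hhalf ε hε
  obtain ⟨M, hM⟩ := hhalf' ε hε
  refine ⟨2 * (N + M) + 1, fun n hn => ?_⟩
  rcases Nat.even_or_odd' n with ⟨m, rfl | rfl⟩
  · exact hN m (by omega)
  · exact hM m (by omega)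

/-- `E` need not be measurable: each cut is made by a measurable half-line, and the Carathéodory
property suffices. -/
theorem measureReal_inter_Ico_eq_sum {D : ℕ → ℝ} (hD : Monotone D) (E : Set ℝ) (n : ℕ) :
    volume.real (E ∩ Set.Ico (D 0) (D n))
      = ∑ j ∈ Finset.range n, volume.real (E ∩ Set.Ico (D j) (D (j + 1))) := by
  have hfin : ∀ a b : ℝ, volume (E ∩ Set.Ico a b) ≠ ⊤ := fun a b =>
    measure_ne_top_of_subset Set.inter_subset_right measure_Ico_lt_top.ne
  induction n with
  | zero => simp
  | succ n ih =>
    have h1 := measureReal_inter_add_sdiff (μ := volume) (s := E ∩ Set.Ico (D 0) (D (n + 1)))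
      (measurableSet_Iio (a := D n)) (hfin _ _)
    have h2 : E ∩ Set.Ico (D 0) (D (n + 1)) ∩ Set.Iio (D n) = E ∩ Set.Ico (D 0) (D n) := by
      ext t
      have := hD n.le_succ
      simp only [Set.mem_inter_iff, Set.mem_Ico, Set.mem_Iio]
      exact ⟨fun h => ⟨h.1.1, h.1.2.1, h.2⟩, fun h => ⟨⟨h.1, h.2.1, h.2.2.trans_le this⟩, h.2.2⟩⟩
    have h3 : (E ∩ Set.Ico (D 0) (D (n + 1))) \ Set.Iio (D n)
        = E ∩ Set.Ico (D n) (D (n + 1)) := by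
      ext t
      have := hD n.zero_le
      simp only [Set.mem_inter_iff, Set.mem_Ico, Set.mem_sdiff, Set.mem_Iio, not_lt]
      exact ⟨fun h => ⟨h.1.1, h.2, h.1.2.2⟩, fun h => ⟨⟨h.1, this.trans h.2.1, h.2.2⟩, h.2.1⟩⟩
    rw [h2, h3] at h1
    rw [Finset.sum_range_succ, ← ih, h1]

/-- The renewal-reward theorem for a single sample path. -/
theorem tendsto_measureReal_inter_Ioc_div {D : ℕ → ℝ} (hD : Monotone D) {E : Set ℝ} {m γ : ℝ}
    (hm : 0 < m) (hDm : Tendsto (fun n : ℕ => D n / n) atTop (𝓝 m))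
    (hE : Tendsto (fun n : ℕ =>
      (∑ j ∈ Finset.range n, volume.real (E ∩ Set.Ico (D j) (D (j + 1)))) / n) atTop (𝓝 γ)) :
    Tendsto (fun T : ℝ => volume.real (E ∩ Set.Ioc 0 T) / T) atTop (𝓝 (γ / m)) := by
  simp_rw [← measureReal_inter_Ico_eq_sum hD] at hE
  set V : ℝ → ℝ := fun T => volume.real (E ∩ Set.Ico (D 0) T) with hV
  have hfin : ∀ a b : ℝ, volume (E ∩ Set.Ico a b) ≠ ⊤ := fun a b =>
    measure_ne_top_of_subset Set.inter_subset_right measure_Ico_lt_top.ne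
  have hVmono : Monotone V := fun s t hst =>
    measureReal_mono (Set.inter_subset_inter_right _ (Set.Ico_subset_Ico_right hst)) (hfin _ _)
  have hVnonneg : ∀ t, 0 ≤ V t := fun t => measureReal_nonneg
  have hDtop : Tendsto D atTop atTop := by
    have := hDm.pos_mul_atTop hm tendsto_natCast_atTop_atTop
    refine this.congr' ?_
    filter_upwards [eventually_gt_atTop 0] with n hn
    have : (n : ℝ) ≠ 0 := by positivity
    field_simp
  choose! N hN using fun (T : ℝ) (hT : D 0 ≤ T) => exists_mem_Ico_of_tendsto hT hDtop
  have hNtop : Tendsto N atTop atTop := by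
    refine tendsto_atTop.2 fun b => ?_
    filter_upwards [eventually_ge_atTop (D 0), eventually_ge_atTop (D b)] with T h0 hb
    by_contra! hlt
    exact absurd ((hN T h0).2.trans_le (hD hlt)) hb.not_gt
  -- With `N T` the cycle containing `T`, the quotient `V T / T` is squeezed between `V (D N) / D (N
  -- + 1)` and `V (D (N + 1)) / D N`.
  have hup : Tendsto (fun n : ℕ => V (D (n + 1)) / D n) atTop (𝓝 (γ / m)) := by
    refine ((tendsto_comp_add_one_div hE).div hDm hm.ne').congr' ?_
    filter_upwards [eventually_gt_atTop 0] with n hn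
    exact div_div_div_cancel_right₀ (by positivity) _ _
  have hlow : Tendsto (fun n : ℕ => V (D n) / D (n + 1)) atTop (𝓝 (γ / m)) := by
    refine (hE.div (tendsto_comp_add_one_div hDm) hm.ne').congr' ?_
    filter_upwards [eventually_gt_atTop 0] with n hn
    exact div_div_div_cancel_right₀ (by positivity) _ _
  have hmid : Tendsto (fun T : ℝ => V T / T) atTop (𝓝 (γ / m)) := by
    refine tendsto_of_tendsto_of_tendsto_of_le_of_le' (hlow.comp hNtop) (hup.comp hNtop) ?_ ?_
    · filter_upwards [eventually_ge_atTop (D 0), eventually_gt_atTop 0] with T h0 hT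
      exact div_le_div₀ (hVnonneg _) (hVmono (hN T h0).1) hT (hN T h0).2.le
    · filter_upwards [eventually_ge_atTop (D 0),
        hNtop.eventually (hDtop.eventually_gt_atTop 0)] with T h0 hT
      exact div_le_div₀ (hVnonneg _) (hVmono (hN T h0).2.le) hT (hN T h0).1
  -- Starting the clock at `0` instead of `D 0` changes the measure by at most `|D 0|`, whatever the
  -- sign of `D 0`.
  have herr : Tendsto (fun T : ℝ => |D 0| / T) atTop (𝓝 0) :=
    tendsto_const_nhds.div_atTop tendsto_id
  have hlo := hmid.sub herr
  have hhi := hmid.add herr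
  rw [sub_zero] at hlo
  rw [add_zero] at hhi
  have hfin' : ∀ a b : ℝ, volume (E ∩ Set.Ioc a b) ≠ ⊤ := fun a b =>
    measure_ne_top_of_subset Set.inter_subset_right measure_Ioc_lt_top.ne
  have hIcc : volume.real (Set.Icc (-|D 0|) 0) = |D 0| := by
    rw [Real.volume_real_Icc, sub_neg_eq_add, zero_add, max_eq_left (abs_nonneg _)]
  have hIcc' : volume.real (Set.Icc 0 |D 0|) = |D 0| := by
    rw [Real.volume_real_Icc, sub_zero, max_eq_left (abs_nonneg _)]
  refine tendsto_of_tendsto_of_tendsto_of_le_of_le' hlo hhi ?_ ?_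
  · filter_upwards [eventually_gt_atTop 0] with T hT
    rw [← sub_div]
    refine div_le_div_of_nonneg_right ?_ hT.le
    rw [sub_le_iff_le_add]
    calc V T ≤ volume.real (E ∩ Set.Ioc 0 T ∪ Set.Icc (-|D 0|) 0) := by
          refine measureReal_mono ?_ (measure_union_ne_top (hfin' _ _) measure_Icc_lt_top.ne)
          rintro t ⟨htE, h1, h2⟩
          rcases le_or_gt t 0 with h | h
          · exact Or.inr ⟨(neg_abs_le _).trans h1, h⟩
          · exact Or.inl ⟨htE, h, h2.le⟩
      _ ≤ _ := measureReal_union_le _ _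
      _ = _ := by rw [hIcc]
  · filter_upwards [eventually_gt_atTop 0] with T hT
    rw [← add_div]
    refine div_le_div_of_nonneg_right ?_ hT.le
    calc volume.real (E ∩ Set.Ioc 0 T) = volume.real (E ∩ Set.Ioo 0 T) :=
          measureReal_congr ((ae_eq_refl E).inter Ioo_ae_eq_Ioc.symm)
      _ ≤ volume.real (E ∩ Set.Ico (D 0) T ∪ Set.Icc 0 |D 0|) := by
          refine measureReal_mono ?_ (measure_union_ne_top (hfin _ _) measure_Icc_lt_top.ne)
          rintro t ⟨htE, h1, h2⟩
          rcases le_or_gt (D 0) t with h | h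
          · exact Or.inl ⟨htE, h, h2⟩
          · exact Or.inr ⟨h1.le, h.le.trans (le_abs_self _)⟩
      _ ≤ _ := measureReal_union_le _ _
      _ = _ := by rw [hIcc']

/-- A bounded function which converges at infinity has the same limit in Cesàro mean. -/
theorem tendsto_integral_Ioc_div {f : ℝ → ℝ} {p C : ℝ} (hf : Measurable f)
    (hC : ∀ t, |f t| ≤ C) (hp : Tendsto f atTop (𝓝 p)) :
    Tendsto (fun T : ℝ => (∫ t in Set.Ioc 0 T, f t) / T) atTop (𝓝 p) := by
  -- The substitution `t = T * u` fixes the domain of integration, so that dominated convergence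
  -- applies.
  have h : Tendsto (fun T : ℝ => ∫ u in Set.Ioc (0 : ℝ) 1, f (T * u)) atTop
      (𝓝 (∫ _ in Set.Ioc (0 : ℝ) 1, p)) := by
    refine tendsto_integral_filter_of_dominated_convergence (fun _ => C)
      (Eventually.of_forall fun T => (hf.comp (measurable_const_mul T)).aestronglyMeasurable)
      (Eventually.of_forall fun T => Eventually.of_forall fun u => hC _)
      (integrable_const _) ?_
    filter_upwards [ae_restrict_mem measurableSet_Ioc] with u hu
    exact hp.comp (tendsto_id.atTop_mul_const hu.1)
  have h1 : (∫ _ in Set.Ioc (0 : ℝ) 1, p) = p := by simp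
  rw [h1] at h
  refine h.congr' ?_
  filter_upwards [eventually_gt_atTop 0] with T hT
  have := intervalIntegral.integral_comp_mul_left (a := 0) (b := 1) f hT.ne'
  rw [mul_zero, mul_one, intervalIntegral.integral_of_le zero_le_one,
    intervalIntegral.integral_of_le hT.le, smul_eq_mul] at this
  rw [this, inv_mul_eq_div]

end Deterministic

/-! ### Laws of large numbers and the violation probability. -/

section Probability

variable {Ω : Type*} [MeasurableSpace Ω] {P : Measure Ω}

theorem integrable_ceil [IsFiniteMeasure P] {f : Ω → ℝ} (hf : Measurable f)
    (hfi : Integrable f P) : Integrable (fun ω => (⌈f ω⌉ : ℝ)) P := by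
  refine (hfi.abs.add (integrable_const (1 : ℝ))).mono'
    (show Measurable fun ω => (⌈f ω⌉ : ℝ) by fun_prop).aestronglyMeasurable
    (Eventually.of_forall fun ω => ?_)
  have h1 := Int.le_ceil (f ω)
  have h2 := Int.ceil_lt_add_one (f ω)
  have h3 := neg_abs_le (f ω)
  have h4 := le_abs_self (f ω)
  rw [Real.norm_eq_abs, abs_le, Pi.add_apply]
  constructor <;> linarith

theorem integral_measureReal_section [IsProbabilityMeasure P] {G : Set (ℝ × Ω)}
    (hG : MeasurableSet G) (T : ℝ) :
    ∫ ω, volume.real ({t | (t, ω) ∈ G} ∩ Set.Ioc 0 T) ∂P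
      = ∫ t in Set.Ioc 0 T, P.real {ω | (t, ω) ∈ G} := by
  have h1 : ∀ ω, volume.real ({t | (t, ω) ∈ G} ∩ Set.Ioc 0 T)
      = ((volume.restrict (Set.Ioc 0 T)) ((fun t => (t, ω)) ⁻¹' G)).toReal := fun ω => by
    rw [measureReal_def, Measure.restrict_apply (measurable_prodMk_right hG)]
    rfl
  simp only [h1]
  rw [integral_toReal (measurable_measure_prodMk_right hG).aemeasurable
    (Eventually.of_forall fun ω => measure_lt_top _ _), ← Measure.prod_apply_symm hG,
    Measure.prod_apply hG, ← integral_toReal (measurable_measure_prodMk_left hG).aemeasurable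
    (Eventually.of_forall fun t => measure_lt_top _ _)]
  rfl

namespace IsDGI11

variable {lam d : ℝ} {X : ℕ → Ω → ℝ} {phase init : Ω → ℝ}

section

variable (hsys : IsDGI11 P lam X phase init)
include hsys

theorem ae_regular : ∀ᵐ ω ∂P, (∀ k, 0 < X k ω) ∧ init ω ≤ phase ω :=
  (ae_all_iff.2 hsys.service_pos).and hsys.init_le

theorem integrable_service (hX : Integrable (X 1) P) (k : ℕ) : Integrable (X (k + 1)) P :=
  (hsys.identDistrib k).integrable_iff.2 hX

theorem identDistrib_ceil (k : ℕ) :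
    IdentDistrib (fun ω => (⌈lam * X (k + 1) ω⌉ : ℝ)) (fun ω => (⌈lam * X 1 ω⌉ : ℝ)) P P :=
  (hsys.identDistrib k).comp (u := fun y : ℝ => (⌈lam * y⌉ : ℝ)) (by fun_prop)

theorem indepFun_service {i j : ℕ} (hij : i ≠ j) : IndepFun (X (i + 1)) (X (j + 1)) P :=
  hsys.indep.indepFun hij

/-- The excess is a fixed function of two consecutive service times, and independence gives all such
pairs with positive first index the same law. -/
theorem identDistrib_excess [IsProbabilityMeasure P] (d : ℝ) (k : ℕ) :
    IdentDistrib (dgiExcess lam d X (k + 1)) (dgiExcess lam d X 1) P P := by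
  have h := ((hsys.identDistrib k).prodMk
    ((hsys.identDistrib (k + 1)).trans (hsys.identDistrib 1).symm)
    (hsys.indepFun_service k.lt_succ_self.ne) (hsys.indepFun_service zero_ne_one))
  exact h.comp (u := fun q : ℝ × ℝ => min (max 0 (q.1 + ((⌈lam * q.1⌉ : ℝ) / lam - q.1) + q.2 - d))
        (q.2 + ((⌈lam * q.1⌉ : ℝ) / lam - q.1))) (by fun_prop)

theorem indepFun_excess (d : ℝ) {i j : ℕ} (hij : i + 1 < j) :
    IndepFun (dgiExcess lam d X (i + 1)) (dgiExcess lam d X (j + 1)) P := by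
  have h := hsys.indep.indepFun_prodMk_prodMk (fun k => hsys.measurable_service (k + 1))
    i (i + 1) j (j + 1) (by omega) (by omega) (by omega) (by omega)
  have hm : Measurable fun q : ℝ × ℝ =>
      min (max 0 (q.1 + ((⌈lam * q.1⌉ : ℝ) / lam - q.1) + q.2 - d))
        (q.2 + ((⌈lam * q.1⌉ : ℝ) / lam - q.1)) := by fun_prop
  exact h.comp hm hm

theorem integrable_ceil_service [IsFiniteMeasure P] (hX : Integrable (X 1) P) (k : ℕ) :
    Integrable (fun ω => (⌈lam * X (k + 1) ω⌉ : ℝ)) P :=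
  integrable_ceil ((hsys.measurable_service _).const_mul lam)
    ((hsys.integrable_service hX k).const_mul lam)

theorem integrable_excess [IsFiniteMeasure P] (hX : Integrable (X 1) P) (d : ℝ) (k : ℕ) :
    Integrable (dgiExcess lam d X (k + 1)) P := by
  have hi : Integrable (dgiIdle lam X (k + 1)) P :=
    ((hsys.integrable_ceil_service hX k).div_const lam).sub (hsys.integrable_service hX k)
  have h1 := hsys.integrable_service hX k
  have h2 := hsys.integrable_service hX (k + 1)
  exact ((integrable_const (0 : ℝ)).sup
    (((h1.add hi).add h2).sub (integrable_const d))).inf (h2.add hi)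

theorem integral_ceil_pos [IsProbabilityMeasure P] (hX : Integrable (X 1) P) (k : ℕ) :
    0 < ∫ ω, (⌈lam * X (k + 1) ω⌉ : ℝ) ∂P := by
  have h : ∫ _, (1 : ℝ) ∂P ≤ ∫ ω, (⌈lam * X (k + 1) ω⌉ : ℝ) ∂P := by
    refine integral_mono_ae (integrable_const _) (hsys.integrable_ceil_service hX k) ?_
    filter_upwards [hsys.service_pos (k + 1)] with ω hω
    have : 0 < ⌈lam * X (k + 1) ω⌉ := Int.ceil_pos.2 (mul_pos hsys.rate_pos hω)
    have h : (1 : ℤ) ≤ ⌈lam * X (k + 1) ω⌉ := this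
    exact_mod_cast h
  simp only [integral_const, probReal_univ, smul_eq_mul, mul_one] at h
  linarith

/-- The excess times are 1-dependent: those with indices of equal parity use disjoint pairs of
service times, so the strong law holds along each parity class. -/
theorem ae_tendsto_sum_excess_div [IsProbabilityMeasure P] (hX : Integrable (X 1) P) (d : ℝ) :
    ∀ᵐ ω ∂P, Tendsto (fun n : ℕ => (∑ i ∈ Finset.range n, dgiExcess lam d X (i + 1) ω) / n) atTop
      (𝓝 (∫ ω, dgiExcess lam d X 1 ω ∂P)) := by
  have he := strong_law_ae_real (fun i => dgiExcess lam d X (2 * i + 1))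
    (hsys.integrable_excess hX d _)
    (fun i j hij => by
      rcases lt_or_gt_of_ne hij with h | h
      · exact hsys.indepFun_excess d (by omega)
      · exact (hsys.indepFun_excess d (by omega)).symm)
    (fun i => (hsys.identDistrib_excess d _).trans (hsys.identDistrib_excess d _).symm)
  have ho := strong_law_ae_real (fun i => dgiExcess lam d X (2 * i + 1 + 1))
    (hsys.integrable_excess hX d _)
    (fun i j hij => by
      rcases lt_or_gt_of_ne hij with h | h
      · exact hsys.indepFun_excess d (by omega)
      · exact (hsys.indepFun_excess d (by omega)).symm)
    (fun i => (hsys.identDistrib_excess d _).trans (hsys.identDistrib_excess d _).symm)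
  rw [(hsys.identDistrib_excess d _).integral_eq] at he ho
  filter_upwards [he, ho] with ω h1 h2
  exact tendsto_sum_div_of_even_odd (u := fun i => dgiExcess lam d X (i + 1) ω) h1 h2

/-- The phase and `X 0` enter as a fixed term that vanishes after division by `n`. Squeezing the
departure between consecutive arrivals avoids a separate estimate of the last service time. -/
theorem ae_tendsto_depTime_div [IsProbabilityMeasure P] (hX : Integrable (X 1) P) :
    ∀ᵐ ω ∂P, Tendsto (fun n : ℕ =>
      depTime (dArrival lam (phase ω)) (fun i => X i ω) (n + 1) / n) atTop
      (𝓝 ((∫ ω, (⌈lam * X 1 ω⌉ : ℝ) ∂P) / lam)) := by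
  have hc := strong_law_ae_real (fun i ω => (⌈lam * X (i + 1) ω⌉ : ℝ))
    (hsys.integrable_ceil_service hX 0)
    (fun i j hij => (hsys.indepFun_service hij).comp (φ := fun y : ℝ => (⌈lam * y⌉ : ℝ))
      (ψ := fun y : ℝ => (⌈lam * y⌉ : ℝ)) (by fun_prop) (by fun_prop))
    (fun i => hsys.identDistrib_ceil i)
  filter_upwards [hsys.ae_regular, hc] with ω ⟨hpos, _⟩ h
  have hlam := hsys.rate_pos
  set A := arrTime (dArrival lam (phase ω)) (fun i => X i ω) with hA
  have h1 : Tendsto (fun n : ℕ => A (n + 1) / n) atTop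
      (𝓝 ((∫ ω, (⌈lam * X 1 ω⌉ : ℝ) ∂P) / lam)) := by
    have h0 : Tendsto (fun n : ℕ => (phase ω + (⌈lam * X 0 ω⌉ : ℝ) / lam) / n) atTop (𝓝 0) :=
      tendsto_const_nhds.div_atTop tendsto_natCast_atTop_atTop
    have := h0.add (h.div_const lam)
    rw [zero_add] at this
    refine this.congr fun n => ?_
    rw [hA, arrTime_eq_sum hlam hpos, Finset.sum_range_succ']
    ring
  have h2 : Tendsto (fun n : ℕ => A (n + 2) / n) atTop
      (𝓝 ((∫ ω, (⌈lam * X 1 ω⌉ : ℝ) ∂P) / lam)) :=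
    tendsto_comp_add_one_div (u := fun n => A (n + 1)) h1
  exact tendsto_of_tendsto_of_tendsto_of_le_of_le h1 h2
    (fun n => div_le_div_of_nonneg_right (arrTime_lt_depTime hpos _).le n.cast_nonneg)
    (fun n => div_le_div_of_nonneg_right (depTime_le_arrTime_succ hlam hpos _) n.cast_nonneg)

theorem ae_tendsto_fraction [IsProbabilityMeasure P] (hX : Integrable (X 1) P) (d : ℝ) :
    ∀ᵐ ω ∂P, Tendsto (fun T : ℝ =>
      volume.real {t : ℝ | 0 < t ∧ t ≤ T ∧ d < dgiAge lam X phase init t ω} / T)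
      atTop (𝓝 (dgiRate P lam X 1 * ∫ ω, dgiExcess lam d X 1 ω ∂P)) := by
  filter_upwards [hsys.ae_regular, hsys.ae_tendsto_depTime_div hX,
    hsys.ae_tendsto_sum_excess_div hX d] with ω ⟨hpos, hinit⟩ hD hg
  have hlam := hsys.rate_pos
  have hc := hsys.integral_ceil_pos hX 0
  have hmono : Monotone fun n =>
      depTime (dArrival lam (phase ω)) (fun i => X i ω) (n + 1) :=
    fun m n hmn => (strictMono_depTime hlam hpos).monotone (Nat.succ_le_succ hmn)
  have h := tendsto_measureReal_inter_Ioc_div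
    (E := {t | d < ageOfInfo (dArrival lam (phase ω)) (fun i => X i ω) (init ω) t})
    hmono (div_pos hc hlam) hD
    (hg.congr fun n => by
      congr 1
      refine Finset.sum_congr rfl fun j _ => ?_
      rw [← excessTime_eq_inter, excessTime_eq hlam hpos hinit]
      rfl)
  have hval : dgiRate P lam X 1 * ∫ ω, dgiExcess lam d X 1 ω ∂P
      = (∫ ω, dgiExcess lam d X 1 ω ∂P) / ((∫ ω, (⌈lam * X 1 ω⌉ : ℝ) ∂P) / lam) := by
    rw [dgiRate]
    field_simp
  rw [hval]
  refine h.congr fun T => ?_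
  congr 2
  ext t
  simp only [Set.mem_inter_iff, Set.mem_ofPred_eq, Set.mem_Ioc, dgiAge]
  tauto

/-- The event of a violation is, up to a null set of sample paths, jointly measurable in the
time and the sample path. -/
theorem exists_measurableSet_violation (d : ℝ) :
    ∃ G : Set (ℝ × Ω), MeasurableSet G ∧
      ∀ᵐ ω ∂P, ∀ t, d < dgiAge lam X phase init t ω ↔ (t, ω) ∈ G := by
  have hXm := hsys.measurable_service
  have hpm := hsys.measurable_phase
  have him := hsys.measurable_init
  -- The closed form of the arrival times is visibly measurable; it agrees with `arrTime` on regular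
  -- paths, which have full measure.
  let A : ℕ → Ω → ℝ := fun k ω =>
    phase ω + (∑ i ∈ Finset.range k, (⌈lam * X i ω⌉ : ℝ)) / lam
  have hA : ∀ k, Measurable (A k) := fun k =>
    hpm.add ((Finset.measurable_fun_sum _ fun i _ => by fun_prop).div_const lam)
  refine ⟨{q | q.1 < A 0 q.2 + X 0 q.2 ∧ d < q.1 - init q.2} ∪
    ⋃ k, {q | A k q.2 + X k q.2 ≤ q.1 ∧ q.1 < A (k + 1) q.2 + X (k + 1) q.2 ∧
      d < q.1 - A k q.2}, ?_, ?_⟩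
  · have hD : ∀ k, Measurable fun q : ℝ × Ω => A k q.2 + X k q.2 := fun k => by fun_prop
    refine MeasurableSet.union ?_ (MeasurableSet.iUnion fun k => ?_)
    · exact (measurableSet_lt measurable_fst (hD 0)).inter
        (measurableSet_lt measurable_const (measurable_fst.sub (him.comp measurable_snd)))
    · exact (measurableSet_le (hD k) measurable_fst).inter
        ((measurableSet_lt measurable_fst (hD (k + 1))).inter
          (measurableSet_lt measurable_const (measurable_fst.sub ((hA k).comp measurable_snd))))
  · filter_upwards [hsys.ae_regular] with ω ⟨hpos, hinit⟩ t
    rw [dgiAge, lt_ageOfInfo_iff hsys.rate_pos hpos hinit]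
    simp only [depTime, arrTime_eq_sum hsys.rate_pos hpos, Set.mem_union, Set.mem_iUnion,
      Set.mem_ofPred_eq, A]

/-- The expected violation fraction has two limits: `p`, as a Cesàro mean after Fubini, and the
almost sure constant, by dominated convergence. -/
theorem eq_of_isViolationProb [IsProbabilityMeasure P] (hX : Integrable (X 1) P) {p : ℝ}
    (hp : IsViolationProb P (dgiAge lam X phase init) d p) :
    p = dgiRate P lam X 1 * ∫ ω, dgiExcess lam d X 1 ω ∂P := by
  obtain ⟨G, hG, hGae⟩ := hsys.exists_measurableSet_violation d
  have hprob : ∀ t, P.real {ω | d < dgiAge lam X phase init t ω} = P.real {ω | (t, ω) ∈ G} := by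
    intro t
    refine measureReal_congr ?_
    filter_upwards [hGae] with ω hω using propext (hω t)
  have hmean : Tendsto (fun T : ℝ => (∫ t in Set.Ioc 0 T, P.real {ω | (t, ω) ∈ G}) / T) atTop
      (𝓝 p) := by
    refine tendsto_integral_Ioc_div (C := 1) (measurable_measure_prodMk_left hG).ennreal_toReal
      (fun t => ?_) (hp.congr hprob)
    rw [abs_of_nonneg measureReal_nonneg]
    exact measureReal_le_one
  have hdom : Tendsto
      (fun T : ℝ => ∫ ω, volume.real ({t | (t, ω) ∈ G} ∩ Set.Ioc 0 T) / T ∂P) atTop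
      (𝓝 (∫ _, dgiRate P lam X 1 * ∫ ω, dgiExcess lam d X 1 ω ∂P ∂P)) := by
    refine tendsto_integral_filter_of_dominated_convergence (fun _ => 1) ?_ ?_
      (integrable_const _) ?_
    · refine Eventually.of_forall fun T => ?_
      have hGT : MeasurableSet (G ∩ Prod.fst ⁻¹' Set.Ioc 0 T) :=
        hG.inter (measurable_fst measurableSet_Ioc)
      exact ((measurable_measure_prodMk_right (μ := volume) hGT).ennreal_toReal.div_const
        T).aestronglyMeasurable
    · filter_upwards [eventually_gt_atTop 0] with T hT
      refine Eventually.of_forall fun ω => ?_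
      rw [Real.norm_eq_abs, abs_of_nonneg (div_nonneg measureReal_nonneg hT.le), div_le_one hT]
      calc volume.real ({t | (t, ω) ∈ G} ∩ Set.Ioc 0 T) ≤ volume.real (Set.Ioc 0 T) :=
            measureReal_mono Set.inter_subset_right measure_Ioc_lt_top.ne
        _ = T := by rw [Real.volume_real_Ioc_of_le hT.le, sub_zero]
    · filter_upwards [hGae, hsys.ae_tendsto_fraction hX d] with ω hω h
      refine h.congr fun T => ?_
      congr 2
      ext t
      simp only [Set.mem_inter_iff, Set.mem_ofPred_eq, Set.mem_Ioc, hω t]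
      tauto
  rw [integral_const, probReal_univ, one_smul] at hdom
  refine tendsto_nhds_unique hmean (hdom.congr fun T => ?_)
  rw [integral_div, integral_measureReal_section hG]

theorem isViolationProb_of_isStationaryProcess [IsProbabilityMeasure P]
    (hX : Integrable (X 1) P)
    (hstat : IsStationaryProcess P (dgiAge lam X phase init)) :
    IsViolationProb P (dgiAge lam X phase init) d
      (dgiRate P lam X 1 * ∫ ω, dgiExcess lam d X 1 ω ∂P) := by
  have hconst : ∀ t, 0 ≤ t → P.real {ω | d < dgiAge lam X phase init t ω}
      = P.real {ω | d < dgiAge lam X phase init 0 ω} := by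
    intro t ht
    -- Only the one-time marginals of the stationary process are needed.
    have h := (hstat 1 (fun _ => 0) t (fun _ => le_rfl) ht).measure_mem_eq
      (measurableSet_lt measurable_const (measurable_pi_apply (0 : Fin 1)) :
        MeasurableSet {y : Fin 1 → ℝ | d < y 0})
    simp only [Set.preimage_ofPred_eq, zero_add] at h
    rw [measureReal_def, h, measureReal_def]
  have hlim : IsViolationProb P (dgiAge lam X phase init) d
      (P.real {ω | d < dgiAge lam X phase init 0 ω}) := by
    refine tendsto_const_nhds.congr' ?_
    filter_upwards [eventually_ge_atTop 0] with t ht using (hconst t ht).symm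
  rwa [← hsys.eq_of_isViolationProb hX hlim]

/-- A departure gap is an arrival gap plus a difference of two service times with equal mean, which
cancels in expectation. -/
theorem dgiRate_eq [IsProbabilityMeasure P] (hX : Integrable (X 1) P) (k : ℕ) :
    dgiRate P lam X (k + 1) =
      1 / ∫ ω, (depTime (dArrival lam (phase ω)) (fun i => X i ω) (k + 1 + 1)
        - depTime (dArrival lam (phase ω)) (fun i => X i ω) (k + 1)) ∂P := by
  have hae : (fun ω => depTime (dArrival lam (phase ω)) (fun i => X i ω) (k + 1 + 1)
      - depTime (dArrival lam (phase ω)) (fun i => X i ω) (k + 1)) =ᵐ[P]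
      fun ω => (⌈lam * X (k + 1) ω⌉ : ℝ) / lam + (X (k + 1 + 1) ω - X (k + 1) ω) := by
    filter_upwards [hsys.ae_regular] with ω ⟨hpos, _⟩
    rw [depTime, depTime, arrTime_succ hsys.rate_pos hpos (k + 1)]
    ring
  have h1 := hsys.integrable_service hX k
  have h2 := hsys.integrable_service hX (k + 1)
  have h3 := (hsys.integrable_ceil_service hX k).div_const lam
  have h4 : Integrable (fun ω => X (k + 1 + 1) ω - X (k + 1) ω) P := h2.sub h1
  rw [integral_congr_ae hae, integral_add h3 h4, integral_sub h2 h1,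
    (hsys.identDistrib k).integral_eq, (hsys.identDistrib (k + 1)).integral_eq, sub_self,
    add_zero, integral_div, one_div_div, dgiRate]

end

end IsDGI11

end Probability

theorem theorem5 {Ω : Type*} [MeasurableSpace Ω] (P : Measure Ω) [IsProbabilityMeasure P]
    (lam d : ℝ) (X : ℕ → Ω → ℝ) (phase init : Ω → ℝ)
    (hsys : IsDGI11 P lam X phase init)
    (hX : Integrable (X 1) P)
    (hd : 1 / lam ≤ d) :
    -- the idle times and the excess times of the system, on almost every sample path
    (∀ᵐ ω ∂P, ∀ k : ℕ,
      idleTime (dArrival lam (phase ω)) (fun i => X i ω) k = dgiIdle lam X k ω ∧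
      excessTime (dArrival lam (phase ω)) (fun i => X i ω) (init ω) d k
        = dgiExcess lam d X k ω) ∧
    ∀ k : ℕ, 1 ≤ k →
      -- the expectations below are finite, and the rate is the expected departure rate
      Integrable (fun ω => (⌈lam * X k ω⌉ : ℝ)) P ∧
      Integrable (dgiExcess lam d X k) P ∧
      0 < dgiRate P lam X k ∧
      dgiRate P lam X k =
        1 / ∫ ω, (depTime (dArrival lam (phase ω)) (fun i => X i ω) (k + 1)
              - depTime (dArrival lam (phase ω)) (fun i => X i ω) k) ∂P ∧
      -- the long-run fraction of time of a violation, on almost every sample path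
      (∀ᵐ ω ∂P, Tendsto
        (fun T : ℝ =>
          volume.real {t : ℝ | 0 < t ∧ t ≤ T ∧ d < dgiAge lam X phase init t ω} / T)
        atTop (𝓝 (dgiRate P lam X k * ∫ ω, dgiExcess lam d X k ω ∂P))) ∧
      -- the violation probability, if it exists
      (∀ p : ℝ, IsViolationProb P (dgiAge lam X phase init) d p →
        p = dgiRate P lam X k * ∫ ω, dgiExcess lam d X k ω ∂P) ∧
      -- the violation probability exists if the age process is stationary
      (IsStationaryProcess P (dgiAge lam X phase init) →
        IsViolationProb P (dgiAge lam X phase init) d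
          (dgiRate P lam X k * ∫ ω, dgiExcess lam d X k ω ∂P)) := by
  refine ⟨?_, fun k hk => ?_⟩
  · filter_upwards [hsys.ae_regular] with ω ⟨hpos, hinit⟩ k
    exact ⟨idleTime_eq hsys.rate_pos hpos k, excessTime_eq hsys.rate_pos hpos hinit d k⟩
  · obtain ⟨k, rfl⟩ := Nat.exists_eq_succ_of_ne_zero (Nat.one_le_iff_ne_zero.1 hk)
    -- Identical distribution makes the value independent of `k`, so the limits are only needed at
    -- index 1.
    have hval : dgiRate P lam X (k + 1) * ∫ ω, dgiExcess lam d X (k + 1) ω ∂P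
        = dgiRate P lam X 1 * ∫ ω, dgiExcess lam d X 1 ω ∂P := by
      rw [dgiRate, dgiRate, (hsys.identDistrib_ceil k).integral_eq,
        (hsys.identDistrib_excess d k).integral_eq]
    rw [Nat.succ_eq_add_one, hval]
    exact ⟨hsys.integrable_ceil_service hX k, hsys.integrable_excess hX d k,
      div_pos hsys.rate_pos (hsys.integral_ceil_pos hX k), hsys.dgiRate_eq hX k,
      hsys.ae_tendsto_fraction hX d, fun p hp => hsys.eq_of_isViolationProb hX hp,
      hsys.isViolationProb_of_isStationaryProcess hX⟩
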